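/- \textbf{Setting.} Let $K$ be a linearly ordered field, for instance the field of nonstandard real numbers (the standard natural numbers being the elements of $\mathbb N$). Let $\pounds=\{x\in K: |x|\le m \text{ for some standard } m\in\mathbb N\}$ be the set of limited numbers and $\oslash=\{x\in K: m|x|<1 \text{ for all standard } m\in\mathbb N\}$ the set of infinitesimals. A \emph{neutrix} is a convex additive subgroup of $K$, and an \emph{external number} is a Minkowski sum $\alpha=a+A$ of some $a\in K$ (a \emph{representative}) and a neutrix $A=N(\alpha)$ (the \emph{neutrix part}). Operations on external numbers are Minkowski operations, $|\alpha|=|a|+A$, and $\alpha\le\beta$ means $\forall a\in\alpha\,\exists b\in\beta\,(a\le b)$; maxima of external numbers refer to this order, and maxima and minima of neutrices to inclusion. $\alpha$ is \emph{zeroless} if $0\notin\alpha$, and it is an \emph{absorber} of a neutrix $N$ if $\alpha N\subsetneq N$. For neutrices, $A:B=\{c\in K: cB\subseteq A\}$. Let $n\ge1$ be a standard natural number, $\mathcal A=[\alpha_{ij}]$ an $n\times n$ matrix and $\mathcal B=(\beta_1,\dots,\beta_n)^T$ a vector of external numbers. The pair $\mathcal A|\mathcal B$ is the flexible system $\mathcal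 Ax\subseteq\mathcal B$. Put $|\overline\alpha|=\max_{i,j}|\alpha_{ij}|$, $\overline A=\max_{i,j}N(\alpha_{ij})$, $|\overline\beta|=\max_i|\beta_i|$, $\underline B=\min_iN(\beta_i)$, and $\Delta=\det\mathcal A=\sum_{\sigma}\operatorname{sgn}(\sigma)\prod_i\alpha_{\sigma(i)i}$. \begin{itemize} \item $\mathcal A$ is \emph{limited} if $|\overline\alpha|\subsetneq\pounds$, and \emph{non-singular} if $\Delta$ is zeroless. It is \emph{reduced} if $|\overline\alpha|=\alpha_{11}=1+N(\alpha_{11})$ with $N(\alpha_{11})\subseteq\oslash$ and every entry has a representative of absolute value at most $1$. Matrices over $K$ are regarded as external matrices with neutrix parts $\{0\}$. \item The relative uncertainties are $R(\mathcal A)=\overline A/\Delta$ for non-singular $\mathcal A$, and $R(\mathcal B)=\underline B/|\overline\beta|$ if $|\overline\beta|$ is zeroless, $R(\mathcal B)=\underline B:|\overline\beta|$ if $|\overline\beta|$ is a neutrix. \item $\mathcal A|\mathcal B$ is \emph{stable} if $\mathcal A$ is limited and non-singular, $R(\mathcal A)\subseteq\oslash$, $R(\mathcal A)\subseteq R(\mathcal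 B)$, and $\Delta$ is not an absorber of $\underline B$. It is \emph{uniform} if all $N(\beta_i)$ are equal. \item A matrix $P=[a_{ij}]$ over $K$ is a \emph{representative matrix} of $\mathcal A$ if $a_{ij}\in\alpha_{ij}$ for all $i,j$. Let $m^{1\cdots k\,i}_{1\cdots k\,j}$ be the minor of $P$ formed by the rows $1,\dots,k,i$ and the columns $1,\dots,k,j$. $P$ is \emph{properly arranged} if $|m^{1\cdots k\,i}_{1\cdots k\,j}|\le|m^{1\cdots k\,k+1}_{1\cdots k\,k+1}|$ whenever $0\le k<n$ and $k+1\le i,j\le n$. A reduced and non-singular matrix $\mathcal A$ is \emph{properly arranged with respect to} $P$ if $P$ is a properly arranged representative matrix of $\mathcal A$. \item The Gauss--Jordan operation matrices $\mathcal G_q$ of $P$ and the matrices $P^{(q)}=[a^{(q)}_{ij}]$ are given by $P^{(0)}=P$ and $P^{(q)}=\mathcal G_qP^{(q-1)}$ for $1\le q\le 2n$. For $0\le k<n$, $\mathcal G_{2k+1}$ is the identity matrix with the diagonal entry in position $(k+1,k+1)$ replaced by $1/a^{(2k)}_{k+1\,k+1}$, and $\mathcal G_{2k+2}$ is the identity matrix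 with the entries in positions $(i,k+1)$, $i\ne k+1$, replaced by $-a^{(2k+1)}_{i\,k+1}$. Put $\mathcal G^P=\mathcal G_{2n}(\mathcal G_{2n-1}\cdots(\mathcal G_2\mathcal G_1))$, $\mathcal A^{(q)}=\mathcal G_q(\mathcal G_{q-1}\cdots(\mathcal G_1\mathcal A))$ and $\mathcal B^{(q)}=\mathcal G_q(\mathcal G_{q-1}\cdots(\mathcal G_1\mathcal B))$, with $\mathcal A^{(0)}=\mathcal A$ and $\mathcal B^{(0)}=\mathcal B$. \item A \emph{near-identity matrix} is a matrix of external numbers which has the identity matrix as a representative matrix and all of whose neutrix parts are contained in $\oslash$. \end{itemize} \textbf{Theorem.} Suppose that $\mathcal A|\mathcal B$ is uniform and stable, that $\mathcal A$ is reduced, and that $\mathcal A$ is properly arranged with respect to a reduced representative matrix $P$. Then: \begin{enumerate} \item for all $q$ with $0\le q\le 2n$ the intermediate system $\mathcal A^{(q)}|\mathcal B^{(q)}$ is stable; \item in particular the final system is stable and its coefficient matrix is a near-identity matrix. This holds both for $\mathcal A^{(2n)}|\mathcal B^{(2n)}$, where the operations are applied one after the other, and for $\mathcal G^P\mathcal A|\mathcal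 G^P\mathcal B$, where the product matrix $\mathcal G^P$ is applied at once. \end{enumerate} -/

import Mathlib

open scoped Pointwise

/-! Throughout, `K` is a linearly ordered field, typically a field of nonstandard reals; the
standard natural numbers are the elements of `ℕ`. Sums and products of sets are Minkowski sums
and products. -/

namespace Flexible

noncomputable section

section Numbers

variable {K : Type*} [Field K] [LinearOrder K]

/-- The set `£` of limited numbers. -/
def limitedSet (K : Type*) [Field K] [LinearOrder K] : Set K :=
  {x | ∃ m : ℕ, |x| ≤ m}

/-- The set `⊘` of infinitesimals: `0` and the numbers whose reciprocal exceeds every standard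
natural number in absolute value. -/
def infinitesimalSet (K : Type*) [Field K] [LinearOrder K] : Set K :=
  {x | ∀ m : ℕ, (m : K) * |x| < 1}

/-- A neutrix is a convex additive subgroup. -/
def IsNeutrix (N : Set K) : Prop :=
  (∃ G : AddSubgroup K, (G : Set K) = N) ∧ N.OrdConnected

/-- An external number is the Minkowski sum of a number and a neutrix. -/
def IsExternal (α : Set K) : Prop :=
  ∃ (a : K) (N : Set K), IsNeutrix N ∧ α = {a} + N

/-- The neutrix part `N(α)`; for `α = a + N` with `N` a neutrix it is `N`, see
`neutrixPart_eq`. -/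
def neutrixPart (α : Set K) : Set K := α - α

theorem neutrixPart_eq {a : K} {N : Set K} (hN : IsNeutrix N) :
    neutrixPart ({a} + N) = N := by
  obtain ⟨⟨G, rfl⟩, -⟩ := hN
  ext x
  simp only [neutrixPart, Set.mem_sub, Set.singleton_add, Set.mem_image, SetLike.mem_coe]
  constructor
  · rintro ⟨_, ⟨y, hy, rfl⟩, _, ⟨z, hz, rfl⟩, rfl⟩
    simpa using G.sub_mem hy hz
  · intro hx
    exact ⟨a + x, ⟨x, hx, rfl⟩, a + 0, ⟨0, G.zero_mem, rfl⟩, by simp⟩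

/-- An external number is zeroless if it does not contain `0`. -/
def IsZeroless (α : Set K) : Prop := (0 : K) ∉ α

/-- The order `α ≤ β` on external numbers. -/
def extLE (α β : Set K) : Prop := ∀ a ∈ α, ∃ b ∈ β, a ≤ b

/-- The absolute value `|a + N| = |a| + N`. -/
def extAbs (α : Set K) : Set K := (fun x => |x|) '' α + neutrixPart α

/-- The maximum of the absolute values of finitely many external numbers, with respect to
`extLE`: the common value of `|α i|` at the indices `i` where it is largest. -/
def maxAbs {ι : Type*} (α : ι → Set K) : Set K :=
  {x | ∃ i, (∀ j, extLE (extAbs (α j)) (extAbs (α i))) ∧ x ∈ extAbs (α i)}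

/-- The largest neutrix part of a finite family of external numbers. Neutrices are totally
ordered by inclusion, so that the maximum is the union. -/
def maxNeutrix {ι : Type*} (α : ι → Set K) : Set K := ⋃ i, neutrixPart (α i)

/-- The smallest neutrix part of a finite family of external numbers. -/
def minNeutrix {ι : Type*} (α : ι → Set K) : Set K := ⋂ i, neutrixPart (α i)

/-- The quotient `A : B = {c | c B ⊆ A}` of neutrices. -/
def colon (A B : Set K) : Set K := {c | {c} * B ⊆ A}

/-- `α` is an absorber of the neutrix `N` if `α N` is strictly contained in `N`. -/
def IsAbsorber (α N : Set K) : Prop := α * N ⊂ N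

end Numbers

section Matrices

variable {K : Type*} [Field K] [LinearOrder K] {n : ℕ}

/-- A matrix of numbers as a matrix of external numbers. -/
def ofReal (P : Matrix (Fin n) (Fin n) K) : Matrix (Fin n) (Fin n) (Set K) :=
  P.map fun x => {x}

/-- The product of a matrix and a vector, in the sense of Minkowski. (For the product of two
matrices with entries in `Set K`, `*` has this meaning.) -/
def extMulVec (A : Matrix (Fin n) (Fin n) (Set K)) (β : Fin n → Set K) : Fin n → Set K :=
  fun i => ∑ j, A i j * β j

/-- The determinant of a matrix of external numbers, as a Minkowski sum of signed products. -/
def extDet (A : Matrix (Fin n) (Fin n) (Set K)) : Set K :=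
  ∑ σ : Equiv.Perm (Fin n), {((Equiv.Perm.sign σ : ℤ) : K)} * ∏ i, A (σ i) i

/-- A matrix is limited if the largest absolute value of an entry is strictly contained
in `£`. -/
def IsLimitedMatrix (A : Matrix (Fin n) (Fin n) (Set K)) : Prop :=
  maxAbs (fun p : Fin n × Fin n => A p.1 p.2) ⊂ limitedSet K

/-- A matrix is non-singular if its determinant is zeroless. -/
def IsNonsingular (A : Matrix (Fin n) (Fin n) (Set K)) : Prop := IsZeroless (extDet A)

/-- A matrix is reduced if the upper left entry has the form `1 + N` with `N ⊆ ⊘` and is the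
largest entry in absolute value, and all entries have representatives of absolute value at
most `1`. -/
structure IsReduced [NeZero n] (A : Matrix (Fin n) (Fin n) (Set K)) : Prop where
  max_eq : maxAbs (fun p : Fin n × Fin n => A p.1 p.2) = A 0 0
  one_mem : (1 : K) ∈ A 0 0
  neutrix_subset : neutrixPart (A 0 0) ⊆ infinitesimalSet K
  exists_abs_le : ∀ i j, ∃ a ∈ A i j, |a| ≤ 1

/-- `P` is a representative matrix of `A`. -/
def IsRepresentative (P : Matrix (Fin n) (Fin n) K) (A : Matrix (Fin n) (Fin n) (Set K)) :
    Prop :=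
  ∀ i j, P i j ∈ A i j

/-- With indices starting from `0`, the minor of `P` formed by the rows `0, …, k - 1, i` and the
columns `0, …, k - 1, j`. -/
def borderedMinor (P : Matrix (Fin n) (Fin n) K) (k : Fin n) (i j : Fin n) : K :=
  (P.submatrix (Fin.snoc (α := fun _ => Fin n) (Fin.castLE k.isLt.le) i)
    (Fin.snoc (α := fun _ => Fin n) (Fin.castLE k.isLt.le) j)).det

/-- `P` is properly arranged: for all `k < n`, the leading principal minor of order `k + 1` is
the largest in absolute value among all the minors obtained by bordering the leading principal
submatrix of order `k`. (For `k = 0` this says that the upper left entry is the largest.) -/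
def IsProperlyArranged (P : Matrix (Fin n) (Fin n) K) : Prop :=
  ∀ k i j : Fin n, k ≤ i → k ≤ j → |borderedMinor P k i j| ≤ |borderedMinor P k k k|

/-- `A` is properly arranged with respect to `P`. -/
structure IsProperlyArrangedWrt [NeZero n] (A : Matrix (Fin n) (Fin n) (Set K))
    (P : Matrix (Fin n) (Fin n) K) : Prop where
  reduced : IsReduced A
  nonsingular : IsNonsingular A
  representative : IsRepresentative P A
  arranged : IsProperlyArranged P

/-- The relative uncertainty `R(A)` of a non-singular matrix: the largest neutrix of its entries
divided by its determinant. -/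
def relUncertainty (A : Matrix (Fin n) (Fin n) (Set K)) : Set K :=
  maxNeutrix (fun p : Fin n × Fin n => A p.1 p.2) / extDet A

open Classical in
/-- The relative uncertainty `R(β)` of an external vector: the quotient of its smallest neutrix
part by its largest component in absolute value if the latter is zeroless, and otherwise (when
the latter is a neutrix) the quotient of these neutrices in the sense of groups. -/
def relUncertaintyVec (β : Fin n → Set K) : Set K :=
  if IsZeroless (maxAbs β) then minNeutrix β / maxAbs β else colon (minNeutrix β) (maxAbs β)

/-- The matrix `A` of external numbers is limited, non-singular and stable. -/
structure IsStableMatrix (A : Matrix (Fin n) (Fin n) (Set K)) : Prop where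
  external : ∀ i j, IsExternal (A i j)
  limited : IsLimitedMatrix A
  nonsingular : IsNonsingular A
  uncertainty : relUncertainty A ⊆ infinitesimalSet K

/-- The flexible system `A | β` is stable. -/
structure IsStableSystem (A : Matrix (Fin n) (Fin n) (Set K)) (β : Fin n → Set K) : Prop where
  external : ∀ i, IsExternal (β i)
  matrix : IsStableMatrix A
  uncertainty : relUncertainty A ⊆ relUncertaintyVec β
  not_absorber : ¬ IsAbsorber (extDet A) (minNeutrix β)

/-- All components of the right-hand side have the same neutrix part. -/
def IsUniform (β : Fin n → Set K) : Prop :=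
  ∀ i j, neutrixPart (β i) = neutrixPart (β j)

/-- The matrix of external numbers `A` has the identity matrix as a representative matrix and
all its neutrix parts are contained in `⊘`. -/
structure IsNearIdentity (A : Matrix (Fin n) (Fin n) (Set K)) : Prop where
  external : ∀ i j, IsExternal (A i j)
  representative : IsRepresentative 1 A
  neutrix_subset : ∀ i j, neutrixPart (A i j) ⊆ infinitesimalSet K

end Matrices

section GaussJordan

variable {K : Type*} [Field K] {n : ℕ}

/-- The elementary matrix of the Gauss-Jordan operation number `q + 1`, computed from the
intermediate matrix `M` with number `q`. The pivot has index `q / 2`, counted from `0`. If `q` is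
even, the operation divides the pivot row by the pivot; if `q` is odd, it eliminates the other
entries of the pivot column. -/
def gjStep (q : ℕ) (M : Matrix (Fin n) (Fin n) K) : Matrix (Fin n) (Fin n) K :=
  Matrix.of fun i j =>
    if Even q then
      if i = j then (if (i : ℕ) = q / 2 then 1 / M i i else 1) else 0
    else
      if i = j then 1 else if (j : ℕ) = q / 2 then -M i j else 0

/-- The intermediate matrices `P^(q)` of a matrix of numbers. -/
def gjReal (P : Matrix (Fin n) (Fin n) K) : ℕ → Matrix (Fin n) (Fin n) K
  | 0 => P
  | q + 1 => gjStep q (gjReal P q) * gjReal P q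

/-- The Gauss-Jordan operation matrix `G_q` of `P`, with `G_0 = 1`. -/
def gjOp (P : Matrix (Fin n) (Fin n) K) : ℕ → Matrix (Fin n) (Fin n) K
  | 0 => 1
  | q + 1 => gjStep q (gjReal P q)

/-- The product `G_q (G_(q-1) ⋯ (G_2 G_1))`. -/
def gjProd (P : Matrix (Fin n) (Fin n) K) : ℕ → Matrix (Fin n) (Fin n) K
  | 0 => 1
  | q + 1 => gjOp P (q + 1) * gjProd P q

/-- The matrix `G^P = G_(2n) (G_(2n-1) ⋯ (G_2 G_1))`. -/
def gjTotal (P : Matrix (Fin n) (Fin n) K) : Matrix (Fin n) (Fin n) K := gjProd P (2 * n)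

variable [LinearOrder K]

/-- The intermediate coefficient matrices `A^(q) = G_q (G_(q-1) ⋯ (G_1 A))`. -/
def gjCoeff (P : Matrix (Fin n) (Fin n) K) (A : Matrix (Fin n) (Fin n) (Set K)) :
    ℕ → Matrix (Fin n) (Fin n) (Set K)
  | 0 => A
  | q + 1 => ofReal (gjOp P (q + 1)) * gjCoeff P A q

/-- The intermediate right-hand sides `β^(q) = G_q (G_(q-1) ⋯ (G_1 β))`. -/
def gjRhs (P : Matrix (Fin n) (Fin n) K) (β : Fin n → Set K) : ℕ → Fin n → Set K
  | 0 => β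
  | q + 1 => extMulVec (ofReal (gjOp P (q + 1))) (gjRhs P β q)

end GaussJordan

end

end Flexible

open scoped Pointwise

set_option linter.unusedSectionVars false

/-! Stability of `A | β` can be read off from one limited representative matrix M. A stable uniform
system yields a neutrix R of infinitesimals and the common neutrix B of the right-hand side such
that every N(α_ij) / det M lies in R, R β_i ⊆ B, and B / det M ⊆ B. Conversely, such data give
stability, because every element of Δ is det M · (1 + r) with r in R, and 1 + r has a limited
inverse. This is `StableData`, with `StableData.of_isStableSystem` and `StableData.isStableSystem`
as the two directions.

The data survive multiplication by G, with the same R and B, as soon as G has a limited inverse H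
and G M is limited (`StableData.mul`); G itself may be unlimited. Two identities do the work. From G
/ det G = adj H, the matrix G / det G is limited, so the neutrices of G A divided by det (G M) stay
in R. From G = (G M) (adj M) / det M, the entries of G map B into itself, since division by det M
does; limitedness of H turns this inclusion into equality of neutrix parts.

The inverse of a Gauss-Jordan step contains only entries of the current matrix, 0 and 1, so
everything reduces to bounding the matrices P^(q). After k pivots the remaining entries are a common
multiple of the bordered minors of P (`exists_mul_borderedMinor`). Proper arrangement therefore
makes the pivot maximal, the normalized pivot row is bounded by 1, and each elimination at most
doubles the bound on the entries, which stays below a standard power of 2. -/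

namespace Flexible

/-! ### Neutrices, limited numbers and infinitesimals -/

section Neutrices

variable {K : Type*} [Field K] [LinearOrder K]

theorem IsNeutrix.zero_mem {N : Set K} (hN : IsNeutrix N) : (0 : K) ∈ N := by
  obtain ⟨⟨G, rfl⟩, -⟩ := hN
  exact G.zero_mem

theorem IsNeutrix.add_mem {N : Set K} (hN : IsNeutrix N) {x y : K} (hx : x ∈ N) (hy : y ∈ N) :
    x + y ∈ N := by
  obtain ⟨⟨G, rfl⟩, -⟩ := hN
  exact G.add_mem hx hy

theorem IsNeutrix.neg_mem {N : Set K} (hN : IsNeutrix N) {x : K} (hx : x ∈ N) : -x ∈ N := by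
  obtain ⟨⟨G, rfl⟩, -⟩ := hN
  exact G.neg_mem hx

theorem IsNeutrix.sub_mem {N : Set K} (hN : IsNeutrix N) {x y : K} (hx : x ∈ N) (hy : y ∈ N) :
    x - y ∈ N := by
  obtain ⟨⟨G, rfl⟩, -⟩ := hN
  exact G.sub_mem hx hy

theorem IsNeutrix.sum_mem {N : Set K} (hN : IsNeutrix N) {ι : Type*} {s : Finset ι} {f : ι → K}
    (hf : ∀ i ∈ s, f i ∈ N) : ∑ i ∈ s, f i ∈ N := by
  obtain ⟨⟨G, rfl⟩, -⟩ := hN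
  exact G.sum_mem hf

theorem IsNeutrix.natCast_mul_mem {N : Set K} (hN : IsNeutrix N) (m : ℕ) {x : K} (hx : x ∈ N) :
    (m : K) * x ∈ N := by
  obtain ⟨⟨G, rfl⟩, -⟩ := hN
  rw [← nsmul_eq_mul]
  exact G.nsmul_mem hx m

/-- To check that a set is a neutrix it suffices to consider sums and smaller elements. -/
theorem IsNeutrix.of_abs_le [IsStrictOrderedRing K] {N : Set K} (h0 : (0 : K) ∈ N)
    (hadd : ∀ x ∈ N, ∀ y ∈ N, x + y ∈ N) (habs : ∀ x ∈ N, ∀ y, |y| ≤ |x| → y ∈ N) :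
    IsNeutrix N := by
  refine ⟨⟨{ carrier := N, add_mem' := fun {x y} hx hy => hadd x hx y hy, zero_mem' := h0,
             neg_mem' := fun {x} hx => habs x hx _ (abs_neg x).le }, rfl⟩, ⟨?_⟩⟩
  rintro x hx y hy z ⟨hxz, hzy⟩
  rcases le_total 0 z with hz | hz
  · exact habs y hy z (abs_le_abs_of_nonneg hz hzy)
  · exact habs x hx z (abs_le_abs_of_nonpos hz hxz)

variable [IsStrictOrderedRing K]

theorem IsNeutrix.mem_of_abs_le {N : Set K} (hN : IsNeutrix N) {x y : K} (hx : x ∈ N)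
    (h : |y| ≤ |x|) : y ∈ N := by
  have hx' : |x| ∈ N := by
    rcases abs_choice x with h | h <;> rw [h]
    exacts [hx, hN.neg_mem hx]
  exact hN.2.out (hN.neg_mem hx') hx' (abs_le.mp h)

/-- Of two elements witnessing the failure of both inclusions, the one of smaller absolute value
lies in both neutrices. -/
theorem IsNeutrix.subset_total {M N : Set K} (hM : IsNeutrix M) (hN : IsNeutrix N) :
    M ⊆ N ∨ N ⊆ M := by
  by_contra! h
  obtain ⟨⟨x, hxM, hxN⟩, ⟨y, hyN, hyM⟩⟩ := And.imp Set.not_subset.mp Set.not_subset.mp h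
  rcases le_total |x| |y| with h | h
  exacts [hxN (hN.mem_of_abs_le hyN h), hyM (hM.mem_of_abs_le hxM h)]

theorem IsNeutrix.iUnion {ι : Type*} [Nonempty ι] {N : ι → Set K} (hN : ∀ i, IsNeutrix (N i)) :
    IsNeutrix (⋃ i, N i) := by
  refine .of_abs_le ?_ ?_ ?_
  · exact Set.mem_iUnion.mpr ⟨Classical.arbitrary ι, (hN _).zero_mem⟩
  · intro x hx y hy
    obtain ⟨i, hi⟩ := Set.mem_iUnion.mp hx
    obtain ⟨j, hj⟩ := Set.mem_iUnion.mp hy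
    rcases (hN i).subset_total (hN j) with h | h
    · exact Set.mem_iUnion.mpr ⟨j, (hN j).add_mem (h hi) hj⟩
    · exact Set.mem_iUnion.mpr ⟨i, (hN i).add_mem hi (h hj)⟩
  · intro x hx y hy
    obtain ⟨i, hi⟩ := Set.mem_iUnion.mp hx
    exact Set.mem_iUnion.mpr ⟨i, (hN i).mem_of_abs_le hi hy⟩

theorem IsNeutrix.preimage_mul {N : Set K} (hN : IsNeutrix N) (c : K) :
    IsNeutrix {x | x * c ∈ N} := by
  refine .of_abs_le ?_ ?_ ?_
  · simpa using hN.zero_mem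
  · intro x hx y hy
    simpa [add_mul] using hN.add_mem hx hy
  · intro x hx y hy
    refine hN.mem_of_abs_le hx ?_
    rw [abs_mul, abs_mul]
    gcongr

theorem IsNeutrix.singleton_mul {N : Set K} (hN : IsNeutrix N) (c : K) : IsNeutrix ({c} * N) := by
  rcases eq_or_ne c 0 with rfl | hc
  · have : ({0} : Set K) * N = {0} := by
      rw [Set.singleton_mul]
      ext x
      simp only [zero_mul, Set.mem_image, Set.mem_singleton_iff]
      exact ⟨fun ⟨_, _, h⟩ => h.symm, fun h => ⟨0, hN.zero_mem, h.symm⟩⟩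
    rw [this]
    refine .of_abs_le rfl ?_ ?_ <;> simp
  · have : ({c} : Set K) * N = {x | x * c⁻¹ ∈ N} := by
      ext x
      simp only [Set.singleton_mul, Set.mem_image, Set.mem_ofPred_eq]
      constructor
      · rintro ⟨y, hy, rfl⟩
        rwa [mul_comm c y, mul_inv_cancel_right₀ hc]
      · intro h
        exact ⟨_, h, by field_simp⟩
    rw [this]
    exact hN.preimage_mul _

theorem IsNeutrix.add {M N : Set K} (hM : IsNeutrix M) (hN : IsNeutrix N) :
    IsNeutrix (M + N) := by
  rcases hM.subset_total hN with h | h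
  · have : M + N = N := by
      refine Set.Subset.antisymm ?_ fun x hx => ⟨0, hM.zero_mem, x, hx, zero_add x⟩
      rintro _ ⟨x, hx, y, hy, rfl⟩
      exact hN.add_mem (h hx) hy
    rwa [this]
  · have : M + N = M := by
      refine Set.Subset.antisymm ?_ fun x hx => ⟨x, hx, 0, hN.zero_mem, add_zero x⟩
      rintro _ ⟨x, hx, y, hy, rfl⟩
      exact hM.add_mem hx (h hy)
    rwa [this]

/-- The ring of limited numbers. -/
def limitedSubring (K : Type*) [Field K] [LinearOrder K] [IsStrictOrderedRing K] : Subring K where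
  carrier := limitedSet K
  mul_mem' := by
    rintro x y ⟨m, hm⟩ ⟨l, hl⟩
    refine ⟨m * l, ?_⟩
    rw [abs_mul, Nat.cast_mul]
    gcongr
  one_mem' := ⟨1, by simp⟩
  add_mem' := by
    rintro x y ⟨m, hm⟩ ⟨l, hl⟩
    refine ⟨m + l, (abs_add_le x y).trans ?_⟩
    rw [Nat.cast_add]
    gcongr
  zero_mem' := ⟨0, by simp⟩
  neg_mem' := by
    rintro x ⟨m, hm⟩
    exact ⟨m, by rwa [abs_neg]⟩

/-- The ring of the numbers that map a given neutrix into itself. -/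
def multiplierSubring {N : Set K} (hN : IsNeutrix N) : Subring K where
  carrier := {c | ∀ x ∈ N, c * x ∈ N}
  mul_mem' := by
    intro a b ha hb x hx
    rw [mul_assoc]
    exact ha _ (hb _ hx)
  one_mem' := by simp
  add_mem' := by
    intro a b ha hb x hx
    rw [add_mul]
    exact hN.add_mem (ha _ hx) (hb _ hx)
  zero_mem' := by
    intro x _
    simpa using hN.zero_mem
  neg_mem' := by
    intro a ha x hx
    rw [neg_mul]
    exact hN.neg_mem (ha _ hx)

theorem limitedSubring_le_multiplierSubring {N : Set K} (hN : IsNeutrix N) :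
    limitedSubring K ≤ multiplierSubring hN := by
  rintro c ⟨m, hm⟩ x hx
  refine hN.mem_of_abs_le (hN.natCast_mul_mem m hx) ?_
  rw [abs_mul, abs_mul, Nat.abs_cast]
  gcongr

theorem IsNeutrix.limited_mul_mem {N : Set K} (hN : IsNeutrix N) {c x : K}
    (hc : c ∈ limitedSubring K) (hx : x ∈ N) : c * x ∈ N :=
  limitedSubring_le_multiplierSubring hN hc x hx

theorem abs_lt_one_of_mem_infinitesimalSet {x : K} (hx : x ∈ infinitesimalSet K) : |x| < 1 := by
  simpa using hx 1

theorem infinitesimal_mem_limitedSubring {x : K} (hx : x ∈ infinitesimalSet K) :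
    x ∈ limitedSubring K :=
  ⟨1, by simpa using (abs_lt_one_of_mem_infinitesimalSet hx).le⟩

theorem limited_mul_infinitesimal {c x : K} (hc : c ∈ limitedSubring K)
    (hx : x ∈ infinitesimalSet K) : c * x ∈ infinitesimalSet K := by
  obtain ⟨m, hm⟩ := hc
  intro l
  calc (l : K) * |c * x| = l * (|c| * |x|) := by rw [abs_mul]
    _ ≤ l * (m * |x|) := by gcongr
    _ = ((l * m : ℕ) : K) * |x| := by push_cast; ring
    _ < 1 := hx _

end Neutrices

/-! ### External numbers, their linear combinations and their order -/

section ExternalNumbers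

variable {K : Type*} [Field K] [LinearOrder K]

theorem IsExternal.isNeutrix {α : Set K} (hα : IsExternal α) : IsNeutrix (neutrixPart α) := by
  obtain ⟨a, N, hN, rfl⟩ := hα
  rwa [neutrixPart_eq hN]

theorem sub_mem_neutrixPart {α : Set K} {a b : K} (ha : a ∈ α) (hb : b ∈ α) :
    a - b ∈ neutrixPart α :=
  Set.sub_mem_sub ha hb

theorem IsExternal.nonempty {α : Set K} (hα : IsExternal α) : α.Nonempty := by
  obtain ⟨a, N, hN, rfl⟩ := hα
  exact ⟨a + 0, Set.add_mem_add rfl hN.zero_mem⟩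

theorem abs_mem_extAbs {α : Set K} (hα : IsExternal α) {a : K} (ha : a ∈ α) :
    |a| ∈ extAbs α :=
  ⟨|a|, ⟨a, ha, rfl⟩, 0, hα.isNeutrix.zero_mem, add_zero _⟩

theorem isExternal_singleton_zero [IsStrictOrderedRing K] : IsExternal ({0} : Set K) :=
  ⟨0, {0}, .of_abs_le rfl (by simp) (by simp), by simp⟩

theorem IsExternal.add [IsStrictOrderedRing K] {α β : Set K} (hα : IsExternal α)
    (hβ : IsExternal β) : IsExternal (α + β) := by
  obtain ⟨a, M, hM, rfl⟩ := hα
  obtain ⟨b, N, hN, rfl⟩ := hβ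
  refine ⟨a + b, M + N, hM.add hN, ?_⟩
  rw [add_add_add_comm, Set.singleton_add_singleton]

theorem IsExternal.singleton_mul [IsStrictOrderedRing K] {α : Set K} (hα : IsExternal α) (c : K) :
    IsExternal ({c} * α) := by
  obtain ⟨a, N, hN, rfl⟩ := hα
  refine ⟨c * a, {c} * N, hN.singleton_mul c, ?_⟩
  simp only [Set.singleton_mul, Set.singleton_add, Set.image_image, mul_add]

theorem isExternal_linearCombination [IsStrictOrderedRing K] {ι : Type*} (s : Finset ι) (g : ι → K)
    {α : ι → Set K} (hα : ∀ i, IsExternal (α i)) : IsExternal (∑ i ∈ s, {g i} * α i) := by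
  classical
  induction s using Finset.induction_on with
  | empty =>
    rw [Finset.sum_empty]
    exact isExternal_singleton_zero
  | insert i s hi ih =>
    rw [Finset.sum_insert hi]
    exact ((hα i).singleton_mul _).add ih

theorem mem_linearCombination {ι : Type*} [Fintype ι] {g : ι → K} {α : ι → Set K} {x : K} :
    x ∈ ∑ i, {g i} * α i ↔ ∃ a : ι → K, (∀ i, a i ∈ α i) ∧ ∑ i, g i * a i = x := by
  rw [Set.mem_fintype_sum]
  constructor
  · rintro ⟨y, hy, rfl⟩
    simp only [Set.singleton_mul, Set.mem_image] at hy
    choose a ha hay using hy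
    exact ⟨a, ha, by simp only [hay]⟩
  · rintro ⟨a, ha, rfl⟩
    exact ⟨fun i => g i * a i, fun i => Set.mul_mem_mul rfl (ha i), rfl⟩

/-- Forming differences commutes with linear combinations because each coefficient is a single
number; neither convexity nor the group property is needed. -/
theorem mem_neutrixPart_linearCombination {ι : Type*} [Fintype ι] {g : ι → K} {α : ι → Set K}
    {x : K} : x ∈ neutrixPart (∑ i, {g i} * α i) ↔
      ∃ a : ι → K, (∀ i, a i ∈ neutrixPart (α i)) ∧ ∑ i, g i * a i = x := by
  constructor
  · rintro ⟨y, hy, z, hz, rfl⟩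
    obtain ⟨a, ha, rfl⟩ := mem_linearCombination.mp hy
    obtain ⟨b, hb, rfl⟩ := mem_linearCombination.mp hz
    exact ⟨a - b, fun i => sub_mem_neutrixPart (ha i) (hb i), by
      simp [mul_sub, Finset.sum_sub_distrib]⟩
  · rintro ⟨a, ha, rfl⟩
    choose b hb c hc hbc using ha
    refine ⟨_, mem_linearCombination.mpr ⟨b, hb, rfl⟩, _,
      mem_linearCombination.mpr ⟨c, hc, rfl⟩, ?_⟩
    simp only [← hbc, mul_sub, Finset.sum_sub_distrib]

/-- If both relations fail, some a in α exceeds all of β and some b in β exceeds all of α, which is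
contradictory. Totality ensures that a finite family has a largest member. -/
theorem extLE_total (α β : Set K) : extLE α β ∨ extLE β α := by
  by_contra! h
  simp only [extLE, not_forall, not_exists, not_and, not_le] at h
  obtain ⟨⟨a, ha, h1⟩, b, hb, h2⟩ := h
  exact lt_asymm (h1 b hb) (h2 a ha)

theorem extLE_trans {α β γ : Set K} (h1 : extLE α β) (h2 : extLE β γ) : extLE α γ := by
  intro a ha
  obtain ⟨b, hb, hab⟩ := h1 a ha
  obtain ⟨c, hc, hbc⟩ := h2 b hb
  exact ⟨c, hc, hab.trans hbc⟩

theorem exists_extLE_max {ι : Type*} [Finite ι] [Nonempty ι] (α : ι → Set K) :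
    ∃ i, ∀ j, extLE (α j) (α i) := by
  classical
  have := Fintype.ofFinite ι
  suffices ∀ s : Finset ι, s.Nonempty → ∃ i, ∀ j ∈ s, extLE (α j) (α i) by
    obtain ⟨i, hi⟩ := this Finset.univ Finset.univ_nonempty
    exact ⟨i, fun j => hi j (Finset.mem_univ j)⟩
  intro s hs
  induction hs using Finset.Nonempty.cons_induction with
  | singleton a => exact ⟨a, fun j hj => by
      rw [Finset.mem_singleton.mp hj]; exact fun x hx => ⟨x, hx, le_rfl⟩⟩
  | cons a s ha hs ih =>
    obtain ⟨i, hi⟩ := ih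
    rcases extLE_total (α a) (α i) with h | h
    · refine ⟨i, fun j hj => ?_⟩
      rcases Finset.mem_cons.mp hj with rfl | hj
      exacts [h, hi j hj]
    · refine ⟨a, fun j hj => ?_⟩
      rcases Finset.mem_cons.mp hj with rfl | hj
      exacts [fun x hx => ⟨x, hx, le_rfl⟩, extLE_trans (hi j hj) h]

end ExternalNumbers

/-! ### Determinants of external matrices -/

section Determinants

variable {K : Type*} [Field K] [LinearOrder K] {n : ℕ}

theorem det_mem_subring {S : Subring K} {M : Matrix (Fin n) (Fin n) K}
    (hM : ∀ i j, M i j ∈ S) : M.det ∈ S := by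
  rw [Matrix.det_apply]
  refine S.sum_mem fun σ _ => ?_
  rw [Units.smul_def]
  exact S.zsmul_mem (S.prod_mem fun i _ => hM _ _) _

theorem adjugate_mem_subring {S : Subring K} {M : Matrix (Fin n) (Fin n) K}
    (hM : ∀ i j, M i j ∈ S) (i j : Fin n) : M.adjugate i j ∈ S := by
  rw [Matrix.adjugate_apply]
  refine det_mem_subring fun a b => ?_
  rw [Matrix.updateRow_apply]
  split_ifs
  · rw [Pi.single_apply]
    split_ifs
    exacts [S.one_mem, S.zero_mem]
  · exact hM a b

theorem det_mem_extDet {M : Matrix (Fin n) (Fin n) K} {A : Matrix (Fin n) (Fin n) (Set K)}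
    (hMA : IsRepresentative M A) : M.det ∈ extDet A := by
  rw [Matrix.det_apply', extDet, Set.mem_fintype_sum]
  exact ⟨_, fun σ => Set.mul_mem_mul rfl
    ((Set.mem_fintype_prod _ _).mpr ⟨_, fun i => hMA (σ i) i, rfl⟩), rfl⟩

variable [IsStrictOrderedRing K]

/-- Telescoping: x X - y Y = x (X - Y) + Y (x - y), where x and Y are limited. -/
theorem prod_sub_prod_mem {N : Set K} (hN : IsNeutrix N) {ι : Type*} (s : Finset ι) {x y : ι → K}
    (hx : ∀ i, x i ∈ limitedSubring K) (hy : ∀ i, y i ∈ limitedSubring K)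
    (hxy : ∀ i, x i - y i ∈ N) : ∏ i ∈ s, x i - ∏ i ∈ s, y i ∈ N := by
  classical
  induction s using Finset.induction_on with
  | empty => simpa using hN.zero_mem
  | insert i s hi ih =>
    rw [Finset.prod_insert hi, Finset.prod_insert hi]
    have h1 := hN.limited_mul_mem (hx i) ih
    have h2 := hN.limited_mul_mem ((limitedSubring K).prod_mem fun j (_ : j ∈ s) => hy j) (hxy i)
    convert hN.add_mem h1 h2 using 1
    ring

/-- The determinant of a limited external matrix differs from the determinant of a
representative by elements of a common limited neutrix of the entries only. -/
theorem sub_det_mem_of_mem_extDet {M : Matrix (Fin n) (Fin n) K}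
    {A : Matrix (Fin n) (Fin n) (Set K)} {N : Set K} (hN : IsNeutrix N)
    (hNlim : N ⊆ limitedSet K) (hM : ∀ i j, M i j ∈ limitedSubring K)
    (hMA : IsRepresentative M A) (hAN : ∀ i j, neutrixPart (A i j) ⊆ N) {x : K}
    (hx : x ∈ extDet A) : x - M.det ∈ N := by
  rw [extDet, Set.mem_fintype_sum] at hx
  obtain ⟨y, hy, rfl⟩ := hx
  rw [Matrix.det_apply', ← Finset.sum_sub_distrib]
  refine hN.sum_mem fun σ _ => ?_
  obtain ⟨_, rfl, z, hz, hyz⟩ := hy σ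
  obtain ⟨w, hw, rfl⟩ := (Set.mem_fintype_prod _ _).mp hz
  have hd : ∀ i, w i - M (σ i) i ∈ N := fun i =>
    hAN _ _ (sub_mem_neutrixPart (hw i) (hMA (σ i) i))
  rw [← hyz]
  simp only [← mul_sub]
  refine hN.limited_mul_mem (intCast_mem _ _)
    (prod_sub_prod_mem hN _ (fun i => ?_) (fun i => hM _ _) hd)
  have := (limitedSubring K).add_mem (hNlim (hd i)) (hM (σ i) i)
  rwa [sub_add_cancel] at this

/-- The determinant of `A` is the determinant of the representative matrix `M` up to a relative
error in the neutrix `R` of infinitesimals. -/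
theorem exists_relError_of_mem_extDet {M : Matrix (Fin n) (Fin n) K}
    {A : Matrix (Fin n) (Fin n) (Set K)} {R : Set K} (hR : IsNeutrix R)
    (hRinf : R ⊆ infinitesimalSet K) (hM : ∀ i j, M i j ∈ limitedSubring K)
    (hMA : IsRepresentative M A) (hd : M.det ≠ 0)
    (hAR : ∀ i j, ∀ x ∈ neutrixPart (A i j), x / M.det ∈ R) {x : K} (hx : x ∈ extDet A) :
    ∃ r ∈ R, x = M.det * (1 + r) := by
  -- The absolute estimate is applied to the neutrix det M · R, which is limited since both factors
  -- are.
  have key : (x - M.det) * M.det⁻¹ ∈ R := by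
    refine sub_det_mem_of_mem_extDet (hR.preimage_mul M.det⁻¹) ?_ hM hMA
      (fun i j y hy => by simpa [div_eq_mul_inv] using hAR i j y hy) hx
    intro y hy
    have := (limitedSubring K).mul_mem
      (infinitesimal_mem_limitedSubring (hRinf hy)) (det_mem_subring hM)
    rwa [inv_mul_cancel_right₀ hd] at this
  exact ⟨_, key, by field_simp; ring⟩

theorem ofReal_mul_apply (G : Matrix (Fin n) (Fin n) K) (A : Matrix (Fin n) (Fin n) (Set K))
    (i j : Fin n) : (ofReal G * A) i j = ∑ k, {G i k} * A k j := rfl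

theorem extMulVec_ofReal_apply (G : Matrix (Fin n) (Fin n) K) (β : Fin n → Set K) (i : Fin n) :
    extMulVec (ofReal G) β i = ∑ k, {G i k} * β k := rfl

theorem sub_mem_of_mem_extAbs {α : Set K} (hα : IsExternal α) {x y : K} (hx : x ∈ extAbs α)
    (hy : y ∈ extAbs α) : x - y ∈ neutrixPart α := by
  obtain ⟨_, ⟨a, ha, rfl⟩, μ, hμ, rfl⟩ := hx
  obtain ⟨_, ⟨b, hb, rfl⟩, ν, hν, rfl⟩ := hy
  have hN := hα.isNeutrix
  have h := hN.mem_of_abs_le (sub_mem_neutrixPart ha hb) (abs_abs_sub_abs_le_abs_sub a b)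
  have := hN.add_mem h (hN.sub_mem hμ hν)
  rwa [sub_add_sub_comm] at this

end Determinants

/-- Since |r| < 1/2, the inverse is bounded by 2. -/
theorem inv_one_add_limited {K : Type*} [Field K] [LinearOrder K] [IsStrictOrderedRing K] {r : K}
    (hr : r ∈ infinitesimalSet K) : 1 + r ≠ 0 ∧ (1 + r)⁻¹ ∈ limitedSubring K := by
  have h2 : 2 * |r| < 1 := by simpa using hr 2
  have h3 : 1 / 2 < 1 + r := by linarith [neg_abs_le r]
  have h4 : 0 < 1 + r := by linarith
  refine ⟨h4.ne', 2, ?_⟩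
  rw [abs_of_pos (inv_pos.mpr h4), inv_le_comm₀ h4 (by simp)]
  simpa using h3.le

/-! ### Stability expressed through a representative matrix -/

section StableData

variable {K : Type*} [Field K] [LinearOrder K] {n : ℕ}

/-- The system `A | β` is stable on account of the representative matrix `M`, with relative
uncertainty in the neutrix `R`, and all components of `β` have the neutrix part `B`. -/
structure StableData (R B : Set K) (M : Matrix (Fin n) (Fin n) K)
    (A : Matrix (Fin n) (Fin n) (Set K)) (β : Fin n → Set K) : Prop where
  external : ∀ i j, IsExternal (A i j)
  external_rhs : ∀ i, IsExternal (β i)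
  representative : IsRepresentative M A
  limited : ∀ i j, M i j ∈ limitedSet K
  det_ne_zero : M.det ≠ 0
  div_det_mem : ∀ i j, ∀ x ∈ neutrixPart (A i j), x / M.det ∈ R
  neutrix_rhs : ∀ i, neutrixPart (β i) = B
  mul_rhs_mem : ∀ r ∈ R, ∀ i, ∀ b ∈ β i, r * b ∈ B
  rhs_div_det_mem : ∀ x ∈ B, x / M.det ∈ B

namespace StableData

variable [IsStrictOrderedRing K] {R B : Set K} {M : Matrix (Fin n) (Fin n) K}
  {A : Matrix (Fin n) (Fin n) (Set K)} {β : Fin n → Set K}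

theorem det_limited (h : StableData R B M A β) : M.det ∈ limitedSubring K :=
  det_mem_subring h.limited

theorem neutrixPart_infinitesimal (h : StableData R B M A β) (hRinf : R ⊆ infinitesimalSet K)
    (i j : Fin n) : neutrixPart (A i j) ⊆ infinitesimalSet K := by
  intro x hx
  rw [← mul_div_cancel₀ x h.det_ne_zero]
  exact limited_mul_infinitesimal h.det_limited (hRinf (h.div_det_mem i j x hx))

/-- The determinant of `A` is the determinant of `M` up to a relative error in `R`. -/
theorem exists_of_mem_extDet (h : StableData R B M A β) (hR : IsNeutrix R)
    (hRinf : R ⊆ infinitesimalSet K) {x : K} (hx : x ∈ extDet A) :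
    ∃ r ∈ R, x = M.det * (1 + r) :=
  exists_relError_of_mem_extDet hR hRinf h.limited h.representative h.det_ne_zero h.div_det_mem hx

theorem relUncertainty_subset (h : StableData R B M A β) (hR : IsNeutrix R)
    (hRinf : R ⊆ infinitesimalSet K) : relUncertainty A ⊆ R := by
  rintro _ ⟨a, ha, δ, hδ, rfl⟩
  obtain ⟨⟨i, j⟩, ha⟩ := Set.mem_iUnion.mp ha
  obtain ⟨r, hr, rfl⟩ := h.exists_of_mem_extDet hR hRinf hδ
  have : a / (M.det * (1 + r)) = (1 + r)⁻¹ * (a / M.det) := by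
    rw [div_mul_eq_div_div, div_eq_inv_mul]
  simp only [this]
  exact hR.limited_mul_mem (inv_one_add_limited (hRinf hr)).2 (h.div_det_mem i j a ha)

theorem isLimitedMatrix (h : StableData R B M A β) (hRinf : R ⊆ infinitesimalSet K) :
    IsLimitedMatrix A := by
  have hlim : ∀ i j, ∃ m : ℕ, |M i j| ≤ m := h.limited
  choose m hm using hlim
  -- The summand 2 absorbs two infinitesimal deviations: that of a from `M i j`, and the term ν of
  -- the absolute value. The bound is itself a limited number that it excludes, whence the strict
  -- inclusion in £.
  have hbound : ∀ x ∈ maxAbs (fun p : Fin n × Fin n => A p.1 p.2),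
      |x| < ((∑ i, ∑ j, m i j + 2 : ℕ) : K) := by
    rintro x ⟨⟨i, j⟩, -, _, ⟨a, ha, rfl⟩, ν, hν, rfl⟩
    have h1 := abs_lt_one_of_mem_infinitesimalSet (h.neutrixPart_infinitesimal hRinf i j hν)
    have h2 := abs_lt_one_of_mem_infinitesimalSet (h.neutrixPart_infinitesimal hRinf i j
      (sub_mem_neutrixPart ha (h.representative i j)))
    have h3 : (m i j : K) ≤ ((∑ i, ∑ j, m i j : ℕ) : K) := by
      refine Nat.cast_le.mpr (le_trans ?_ (Finset.single_le_sum (f := fun i => ∑ j, m i j)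
        (fun _ _ => Nat.zero_le _) (Finset.mem_univ i)))
      exact Finset.single_le_sum (f := fun j => m i j)
        (fun _ _ => Nat.zero_le _) (Finset.mem_univ j)
    have h4 : |a| ≤ |a - M i j| + |M i j| := by
      simpa using abs_add_le (a - M i j) (M i j)
    have h5 := abs_add_le |a| ν
    rw [abs_abs] at h5
    have h6 := hm i j
    rw [Nat.cast_add, Nat.cast_ofNat]
    exact lt_of_le_of_lt h5 (by linarith)
  refine ⟨fun x hx => ⟨_, (hbound x hx).le⟩, fun hsub => ?_⟩
  have := hbound _ (hsub ⟨∑ i, ∑ j, m i j + 2, (Nat.abs_cast _).le⟩)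
  rw [Nat.abs_cast] at this
  exact lt_irrefl _ this

theorem isStableMatrix (h : StableData R B M A β) (hR : IsNeutrix R)
    (hRinf : R ⊆ infinitesimalSet K) : IsStableMatrix A where
  external := h.external
  limited := h.isLimitedMatrix hRinf
  nonsingular := by
    intro h0
    obtain ⟨r, hr, h0⟩ := h.exists_of_mem_extDet hR hRinf h0
    exact mul_ne_zero h.det_ne_zero (inv_one_add_limited (hRinf hr)).1 h0.symm
  uncertainty := (h.relUncertainty_subset hR hRinf).trans hRinf

theorem minNeutrix_eq [NeZero n] (h : StableData R B M A β) : minNeutrix β = B := by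
  simp only [minNeutrix, h.neutrix_rhs]
  exact Set.iInter_const B

theorem mul_maxAbs_mem (h : StableData R B M A β) (hB : IsNeutrix B)
    (hRinf : R ⊆ infinitesimalSet K) {r y : K} (hr : r ∈ R) (hy : y ∈ maxAbs β) : r * y ∈ B := by
  obtain ⟨i, -, _, ⟨b, hb, rfl⟩, ν, hν, rfl⟩ := hy
  rw [h.neutrix_rhs] at hν
  simp only [mul_add]
  refine hB.add_mem (hB.mem_of_abs_le (h.mul_rhs_mem r hr i b hb) ?_)
    (hB.limited_mul_mem (infinitesimal_mem_limitedSubring (hRinf hr)) hν)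
  rw [abs_mul, abs_mul, abs_abs]

theorem subset_relUncertaintyVec [NeZero n] (h : StableData R B M A β) (hB : IsNeutrix B)
    (hRinf : R ⊆ infinitesimalSet K) : R ⊆ relUncertaintyVec β := by
  intro r hr
  rw [relUncertaintyVec, h.minNeutrix_eq]
  split_ifs with hz
  · obtain ⟨i, hi⟩ := exists_extLE_max fun i => extAbs (β i)
    obtain ⟨b, hb⟩ := (h.external_rhs i).nonempty
    -- An actual element y of the maximum is needed to write r as the quotient (r y) / y.
    have hmem : |b| ∈ maxAbs β := ⟨i, hi, abs_mem_extAbs (h.external_rhs i) hb⟩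
    refine ⟨_, h.mul_maxAbs_mem hB hRinf hr hmem, _, hmem, ?_⟩
    exact mul_div_cancel_right₀ r (ne_of_mem_of_not_mem hmem hz)
  · rintro _ ⟨_, rfl, y, hy, rfl⟩
    exact h.mul_maxAbs_mem hB hRinf hr hy

theorem isStableSystem [NeZero n] (h : StableData R B M A β) (hR : IsNeutrix R) (hB : IsNeutrix B)
    (hRinf : R ⊆ infinitesimalSet K) : IsStableSystem A β where
  external := h.external_rhs
  matrix := h.isStableMatrix hR hRinf
  uncertainty := (h.relUncertainty_subset hR hRinf).trans (h.subset_relUncertaintyVec hB hRinf)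
  not_absorber := by
    rw [h.minNeutrix_eq]
    refine fun hab => hab.2 fun x hx => ?_
    exact ⟨M.det, det_mem_extDet h.representative, _, h.rhs_div_det_mem x hx,
      mul_div_cancel₀ x h.det_ne_zero⟩

theorem isNearIdentity (h : StableData R B 1 A β) (hRinf : R ⊆ infinitesimalSet K) :
    IsNearIdentity A :=
  ⟨h.external, h.representative, h.neutrixPart_infinitesimal hRinf⟩

/-- A stable uniform system with a limited representative matrix. -/
theorem of_isStableSystem [NeZero n] (hunif : IsUniform β) (hs : IsStableSystem A β)
    (hMA : IsRepresentative M A) (hM : ∀ i j, M i j ∈ limitedSet K) :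
    ∃ R B, IsNeutrix R ∧ IsNeutrix B ∧ R ⊆ infinitesimalSet K ∧ StableData R B M A β := by
  have hdet : M.det ∈ extDet A := det_mem_extDet hMA
  have hd : M.det ≠ 0 := ne_of_mem_of_not_mem hdet hs.matrix.nonsingular
  have hmax : IsNeutrix (maxNeutrix fun p : Fin n × Fin n => A p.1 p.2) :=
    .iUnion fun p => (hs.matrix.external p.1 p.2).isNeutrix
  have hRsub : {x | x * M.det ∈ maxNeutrix fun p : Fin n × Fin n => A p.1 p.2} ⊆
      relUncertainty A := fun x hx => ⟨_, hx, _, hdet, mul_div_cancel_right₀ x hd⟩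
  have hR := hmax.preimage_mul M.det
  -- R is the largest neutrix of the entries divided by det M. It is contained in R(A) because det M
  -- belongs to Δ.
  set R := {x | x * M.det ∈ maxNeutrix fun p : Fin n × Fin n => A p.1 p.2} with hRdef
  have hRinf : R ⊆ infinitesimalSet K := hRsub.trans hs.matrix.uncertainty
  have hB : ∀ i, neutrixPart (β i) = neutrixPart (β 0) := fun i => hunif i 0
  have hBn : IsNeutrix (neutrixPart (β 0)) := (hs.external 0).isNeutrix
  set B := neutrixPart (β 0) with hBdef
  have hmin : minNeutrix β = B := by
    simp only [minNeutrix, hB]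
    exact Set.iInter_const B
  have hdiv : ∀ i j, ∀ x ∈ neutrixPart (A i j), x / M.det ∈ R := by
    intro i j x hx
    rw [hRdef, Set.mem_ofPred_eq, div_mul_cancel₀ x hd]
    exact Set.mem_iUnion.mpr ⟨(i, j), hx⟩
  have hcore : ∀ x ∈ extDet A, ∃ r ∈ R, x = M.det * (1 + r) := fun x hx =>
    exists_relError_of_mem_extDet hR hRinf hM hMA hd hdiv hx
  -- It suffices to control r on one maximal |β_k|, since every |b| with b in β_i lies below some
  -- element of it.
  have hRmax : ∀ r ∈ R, ∃ k, (∀ j, extLE (extAbs (β j)) (extAbs (β k))) ∧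
      ∀ z ∈ extAbs (β k), r * z ∈ B := by
    intro r hr
    have hru := hs.uncertainty (hRsub hr)
    rw [relUncertaintyVec, hmin] at hru
    split_ifs at hru with hz
    · obtain ⟨b, hb, y, ⟨k, hk, hy⟩, rfl⟩ := hru
      refine ⟨k, hk, fun z hzk => ?_⟩
      have hy0 : y ≠ 0 := ne_of_mem_of_not_mem (⟨k, hk, hy⟩ : y ∈ maxAbs β) hz
      have h1 : z - y ∈ B := hB k ▸ sub_mem_of_mem_extAbs (hs.external k) hzk hy
      -- Here r = b / y; any other z in |β_k| differs from y by an element of B, which the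
      -- infinitesimal r keeps in B.
      have h2 : b / y * z = b + b / y * (z - y) := by field_simp; ring
      simp only [h2]
      exact hBn.add_mem hb
        (hBn.limited_mul_mem (infinitesimal_mem_limitedSubring (hRinf hr)) h1)
    · obtain ⟨k, hk⟩ := exists_extLE_max fun i => extAbs (β i)
      exact ⟨k, hk, fun z hzk => hru ⟨r, rfl, z, ⟨k, hk, hzk⟩, rfl⟩⟩
  refine ⟨R, B, hR, hBn, hRinf, hs.matrix.external, hs.external, hMA, hM, hd, hdiv, hB, ?_, ?_⟩
  · intro r hr i b hb
    obtain ⟨k, hk, hrk⟩ := hRmax r hr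
    obtain ⟨z, hz, hbz⟩ := hk i _ (abs_mem_extAbs (hs.external i) hb)
    refine hBn.mem_of_abs_le (hrk z hz) ?_
    rw [abs_mul, abs_mul]
    exact mul_le_mul_of_nonneg_left (hbz.trans (le_abs_self z)) (abs_nonneg r)
  · intro x hx
    -- Elements of Δ are limited, so Δ B ⊆ B; not being an absorber then forces equality. Each x in
    -- B is thus det M · (1 + r) · b with b in B, and the factor det M can be cancelled.
    have hlim : extDet A ⊆ multiplierSubring hBn := by
      intro y hy
      obtain ⟨r, hr, rfl⟩ := hcore y hy
      exact limitedSubring_le_multiplierSubring hBn (mul_mem (det_mem_subring hM)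
        (add_mem (one_mem _) (infinitesimal_mem_limitedSubring (hRinf hr))))
    have hsub : extDet A * B ⊆ B := by
      rintro _ ⟨y, hy, b, hb, rfl⟩
      exact hlim hy b hb
    have hna := hs.not_absorber
    rw [hmin] at hna
    have : B ⊆ extDet A * B := by
      by_contra hc
      exact hna ⟨hsub, hc⟩
    obtain ⟨y, hy, b, hb, rfl⟩ := this hx
    obtain ⟨r, hr, rfl⟩ := hcore y hy
    have : M.det * (1 + r) * b / M.det = (1 + r) * b := by field_simp
    simp only [this]
    exact hBn.limited_mul_mem
      (add_mem (one_mem _) (infinitesimal_mem_limitedSubring (hRinf hr))) hb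

/-- Stability is preserved by multiplication with the inverse of a limited matrix, as long as the
representative matrix remains limited. -/
theorem mul (h : StableData R B M A β) (hR : IsNeutrix R) (hB : IsNeutrix B)
    {G H : Matrix (Fin n) (Fin n) K} (hGH : G * H = 1) (hH : ∀ i j, H i j ∈ limitedSet K)
    (hGM : ∀ i j, (G * M) i j ∈ limitedSet K) :
    StableData R B (G * M) (ofReal G * A) (extMulVec (ofReal G) β) := by
  have hd := h.det_ne_zero
  have hdGH : G.det * H.det = 1 := by rw [← Matrix.det_mul, hGH, Matrix.det_one]
  have hdG : G.det ≠ 0 := left_ne_zero_of_mul_eq_one hdGH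
  have hdH : H.det = G.det⁻¹ := eq_inv_of_mul_eq_one_right hdGH
  -- G / det G is the adjugate of the limited matrix H.
  have hGadj : ∀ i j, G i j / G.det ∈ limitedSubring K := by
    intro i j
    have hadj : H.adjugate = H.det • G := by
      rw [← one_mul H.adjugate, ← hGH, mul_assoc, Matrix.mul_adjugate, Matrix.mul_smul, mul_one]
    have := adjugate_mem_subring (S := limitedSubring K) hH i j
    rwa [hadj, Matrix.smul_apply, smul_eq_mul, hdH, ← div_eq_inv_mul] at this
  have hS := limitedSubring_le_multiplierSubring hB
  -- G is recovered as (G M) (adj M) / det M, each factor of which preserves B.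
  have hGB : ∀ i j, G i j ∈ multiplierSubring hB := by
    intro i j
    have hadj : G * M * M.adjugate = M.det • G := by
      rw [mul_assoc, Matrix.mul_adjugate, Matrix.mul_smul, mul_one]
    have hdet : M.det⁻¹ ∈ multiplierSubring hB := fun x hx => by
      rw [← div_eq_inv_mul]
      exact h.rhs_div_det_mem x hx
    have hmem : (G * M * M.adjugate) i j ∈ multiplierSubring hB := by
      rw [Matrix.mul_apply]
      exact sum_mem fun k _ => mul_mem (hS (hGM i k))
        (hS (adjugate_mem_subring (S := limitedSubring K) h.limited k j))
    rw [hadj, Matrix.smul_apply, smul_eq_mul] at hmem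
    simpa only [inv_mul_cancel_left₀ hd] using mul_mem hdet hmem
  refine ⟨fun i j => ?_, fun i => ?_, ?_, hGM, ?_, ?_, ?_, ?_, ?_⟩
  · rw [ofReal_mul_apply]
    exact isExternal_linearCombination _ _ fun k => h.external k j
  · rw [extMulVec_ofReal_apply]
    exact isExternal_linearCombination _ _ h.external_rhs
  · intro i j
    exact mem_linearCombination.mpr ⟨fun k => M k j, fun k => h.representative k j, rfl⟩
  · rw [Matrix.det_mul]
    exact mul_ne_zero hdG hd
  · intro i j x hx
    rw [ofReal_mul_apply] at hx
    obtain ⟨a, ha, rfl⟩ := mem_neutrixPart_linearCombination.mp hx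
    rw [Finset.sum_div, Matrix.det_mul]
    refine hR.sum_mem fun k _ => ?_
    rw [mul_div_mul_comm]
    exact hR.limited_mul_mem (hGadj i k) (h.div_det_mem k j _ (ha k))
  · intro i
    rw [extMulVec_ofReal_apply]
    ext x
    constructor
    · intro hx
      obtain ⟨a, ha, rfl⟩ := mem_neutrixPart_linearCombination.mp hx
      exact hB.sum_mem fun k _ => hGB i k _ (h.neutrix_rhs k ▸ ha k)
    · intro hx
      -- The witness is x times column i of H: row i of G sends this vector back to x.
      refine mem_neutrixPart_linearCombination.mpr ⟨fun k => H k i * x, fun k => ?_, ?_⟩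
      · rw [h.neutrix_rhs]
        exact hB.limited_mul_mem (hH k i) hx
      · have : ∑ k, G i k * H k i = 1 := by
          rw [← Matrix.mul_apply, hGH, Matrix.one_apply_eq]
        simp only [← mul_assoc, ← Finset.sum_mul, this, one_mul]
  · intro r hr i b hb
    obtain ⟨a, ha, rfl⟩ := mem_linearCombination.mp hb
    rw [Finset.mul_sum]
    refine hB.sum_mem fun k _ => ?_
    rw [mul_left_comm]
    exact hGB i k _ (h.mul_rhs_mem r hr k _ (ha k))
  · intro x hx
    rw [Matrix.det_mul, mul_comm, ← div_div, div_eq_inv_mul, ← hdH]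
    exact hB.limited_mul_mem (det_mem_subring hH) (h.rhs_div_det_mem x hx)

end StableData
end StableData

/-! ### Gauss-Jordan steps and their inverses -/

section Elimination

variable {K : Type*} [Field K] {n : ℕ}

theorem gjReal_eq_gjProd_mul (P : Matrix (Fin n) (Fin n) K) (q : ℕ) :
    gjReal P q = gjProd P q * P := by
  induction q with
  | zero => rw [gjReal, gjProd, one_mul]
  | succ q ih => rw [gjProd, gjOp, mul_assoc, ← ih, gjReal]

/-- The even numbered operations divide the pivot row by the pivot. -/
theorem gjStep_two_mul (k : Fin n) (M : Matrix (Fin n) (Fin n) K) :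
    gjStep (2 * k) M = Matrix.diagonal fun i => if i = k then 1 / M k k else 1 := by
  ext i j
  simp only [gjStep, Matrix.of_apply, even_two_mul, if_true, Matrix.diagonal_apply,
    Nat.mul_div_cancel_left (k : ℕ) two_pos, ← Fin.ext_iff]
  by_cases hik : i = k <;> simp [hik]

theorem gjStep_two_mul_add_one (k : Fin n) (M : Matrix (Fin n) (Fin n) K) (i j : Fin n) :
    gjStep (2 * k + 1) M i j = if i = j then 1 else if j = k then -M i j else 0 := by
  have h : (2 * (k : ℕ) + 1) / 2 = k := by omega
  simp only [gjStep, Matrix.of_apply, Nat.not_even_two_mul_add_one, if_false, h, ← Fin.ext_iff]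

theorem gjStep_two_mul_mul_apply (k : Fin n) (M N : Matrix (Fin n) (Fin n) K) (i j : Fin n) :
    (gjStep (2 * k) M * N) i j = if i = k then N i j / M k k else N i j := by
  rw [gjStep_two_mul, Matrix.diagonal_mul]
  split_ifs
  · rw [one_div, div_eq_inv_mul]
  · rw [one_mul]

theorem gjStep_two_mul_add_one_mul_apply (k : Fin n) (M N : Matrix (Fin n) (Fin n) K)
    (i j : Fin n) :
    (gjStep (2 * k + 1) M * N) i j = if i = k then N i j else N i j - M i k * N k j := by
  rw [Matrix.mul_apply]
  split_ifs with hik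
  · subst hik
    rw [Finset.sum_eq_single i]
    · simp [gjStep_two_mul_add_one]
    · intro l _ hl
      simp [gjStep_two_mul_add_one, hl, hl.symm]
    · simp
  · rw [Finset.sum_eq_add i k hik]
    · simp [gjStep_two_mul_add_one, hik, sub_eq_add_neg]
    · intro l _ hl
      simp [gjStep_two_mul_add_one, hl.1.symm, hl.2]
    · simp
    · simp

/-- The inverse of a pivot division is the multiplication by the pivot. -/
theorem gjStep_two_mul_mul_diagonal (k : Fin n) (M : Matrix (Fin n) (Fin n) K)
    (hM : M k k ≠ 0) :
    gjStep (2 * k) M * Matrix.diagonal (fun i => if i = k then M k k else 1) = 1 := by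
  rw [gjStep_two_mul, Matrix.diagonal_mul_diagonal, ← Matrix.diagonal_one]
  congr 1
  ext i
  split_ifs
  · exact one_div_mul_cancel hM
  · exact one_mul 1

/-- Changing the sign of M changes the sign of the off-diagonal entries of the elimination matrix,
which undoes the elimination. -/
theorem gjStep_two_mul_add_one_mul_neg (k : Fin n) (M : Matrix (Fin n) (Fin n) K) :
    gjStep (2 * k + 1) M * gjStep (2 * k + 1) (-M) = 1 := by
  ext i j
  rw [gjStep_two_mul_add_one_mul_apply, gjStep_two_mul_add_one, gjStep_two_mul_add_one,
    Matrix.one_apply]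
  by_cases hij : i = j
  · subst hij
    by_cases hik : i = k
    · simp [hik]
    · simp [hik, Ne.symm hik]
  · by_cases hjk : j = k
    · subst hjk
      simp [hij]
    · simp [hij, hjk, Ne.symm hjk]

/-- The first `2 k` operations only involve the first `k` columns. -/
theorem gjProd_two_mul_apply_of_le (P : Matrix (Fin n) (Fin n) K) {k : ℕ} (hk : k ≤ n)
    (i j : Fin n) (hj : k ≤ j) : gjProd P (2 * k) i j = (1 : Matrix (Fin n) (Fin n) K) i j := by
  induction k generalizing i with
  | zero => rfl
  | succ k ih =>
    have ih := fun i => ih (by omega) i (by omega)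
    have hjk : (⟨k, by omega⟩ : Fin n) ≠ j := fun h => by
      rw [← h] at hj
      simp at hj
    rw [show 2 * (k + 1) = 2 * k + 1 + 1 by ring, gjProd, gjProd, gjOp, gjOp,
      gjStep_two_mul_add_one_mul_apply ⟨k, by omega⟩, gjStep_two_mul_mul_apply ⟨k, by omega⟩,
      gjStep_two_mul_mul_apply ⟨k, by omega⟩]
    simp only [ih, Matrix.one_apply]
    by_cases hik : i = ⟨k, by omega⟩
    · simp [hik, hjk]
    · simp [hik, hjk]

end Elimination

/-! ### Pivots, bordered minors and bounds on the intermediate matrices -/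

section Pivots

variable {K : Type*} [Field K] {n : ℕ}

/-- If `M` is an identity matrix from column `k` on and `M * P` is one before column `k`, then the
remaining entries of `M * P` are proportional to the bordered minors of `P`. -/
theorem exists_mul_borderedMinor (k : Fin n) {M P : Matrix (Fin n) (Fin n) K}
    (hM : ∀ i j, k ≤ j → M i j = (1 : Matrix (Fin n) (Fin n) K) i j)
    (hMP : ∀ i j, j < k → (M * P) i j = (1 : Matrix (Fin n) (Fin n) K) i j) :
    ∃ c : K, ∀ i j, k ≤ i → k ≤ j → (M * P) i j = c * borderedMinor P k i j := by
  have hlt : ∀ a : Fin k, Fin.castLE k.isLt.le a < k := fun a => a.isLt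
  -- The factor is the leading principal minor of M of order k, which depends on neither i nor j.
  refine ⟨(M.submatrix (Fin.castLE k.isLt.le) (Fin.castLE k.isLt.le)).det, fun i j hi hj => ?_⟩
  set f : Fin n → Fin ((k : ℕ) + 1) → Fin n :=
    fun i => Fin.snoc (α := fun _ => Fin n) (Fin.castLE k.isLt.le) i with hf
  have hflast : ∀ i, f i (Fin.last k) = i := fun i => Fin.snoc_last _ _
  have hfcast : ∀ i a, f i (Fin.castSucc a) = Fin.castLE k.isLt.le a :=
    fun i a => Fin.snoc_castSucc (α := fun _ => Fin n) _ _ _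
  have hinj : Function.Injective (f i) := by
    intro a b hab
    induction a using Fin.lastCases <;> induction b using Fin.lastCases <;>
      simp only [hflast, hfcast] at hab
    · rfl
    · exact absurd (hab ▸ hi) (hlt _).not_ge
    · exact absurd (hab ▸ hi) (hlt _).not_ge
    · rw [Fin.castLE_injective _ hab]
  -- An index l omitted from the selection satisfies k ≤ l, so column l of M is that of the identity
  -- and vanishes on the selected rows.
  have hprod : (M * P).submatrix (f i) (f j) =
      M.submatrix (f i) (f i) * P.submatrix (f i) (f j) := by
    ext a b
    simp only [Matrix.submatrix_apply, Matrix.mul_apply]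
    symm
    refine Fintype.sum_of_injective (f i) hinj _ _ (fun l hl => ?_) fun _ => rfl
    have hkl : k ≤ l := by
      by_contra! hlk
      exact hl ⟨Fin.castSucc ⟨l, hlk⟩, hfcast i _⟩
    rw [hM _ l hkl, Matrix.one_apply_ne (fun h => hl ⟨a, h⟩), zero_mul]
  -- The first k columns are those of the identity, so the matrix is upper triangular with diagonal
  -- 1, …, 1, (M P)_ij.
  have hleft : ((M * P).submatrix (f i) (f j)).det = (M * P) i j := by
    rw [Matrix.det_of_isUpperTriangular, Fin.prod_univ_castSucc]
    · simp only [Matrix.submatrix_apply, hfcast, hflast, hMP _ _ (hlt _), Matrix.one_apply_eq,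
        Finset.prod_const_one, one_mul]
    · intro a b hba
      simp only [id] at hba
      induction b using Fin.lastCases with
      | last => exact absurd hba (Fin.le_last a).not_gt
      | cast b =>
        rw [Matrix.submatrix_apply, hfcast, hMP _ _ (hlt _), Matrix.one_apply_ne]
        induction a using Fin.lastCases with
        | last =>
          rw [hflast]
          exact ((hlt b).trans_le hi).ne'
        | cast a =>
          rw [hfcast]
          exact fun h => hba.ne' (congrArg Fin.castSucc (Fin.castLE_injective _ h))
  -- The last column is that of the identity; expansion along it leaves only the leading minor.
  have hright : (M.submatrix (f i) (f i)).det =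
      (M.submatrix (Fin.castLE k.isLt.le) (Fin.castLE k.isLt.le)).det := by
    rw [Matrix.det_succ_column _ (Fin.last k), Fin.sum_univ_castSucc, Finset.sum_eq_zero]
    · have h1 : (M.submatrix (f i) (f i)).submatrix (Fin.last (k : ℕ)).succAbove
          (Fin.last (k : ℕ)).succAbove =
          M.submatrix (Fin.castLE k.isLt.le) (Fin.castLE k.isLt.le) := by
        ext a b
        simp only [Matrix.submatrix_apply, Fin.succAbove_last, hfcast]
      rw [h1]
      simp [hflast, hM _ _ hi, ← two_mul]
    · intro a _
      rw [Matrix.submatrix_apply, hflast, hfcast, hM _ _ hi,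
        Matrix.one_apply_ne ((hlt a).trans_le hi).ne]
      simp
  rw [← hleft, hprod, Matrix.det_mul, hright]
  rfl

variable [LinearOrder K]

/-- The state of the elimination after `k` pivots. -/
structure IsEliminated (P : Matrix (Fin n) (Fin n) K) (k : ℕ) : Prop where
  abs_le : ∀ i j, |gjReal P (2 * k) i j| ≤ 2 ^ k
  column : ∀ i j : Fin n, (j : ℕ) < k →
    gjReal P (2 * k) i j = (1 : Matrix (Fin n) (Fin n) K) i j
  det_ne_zero : (gjReal P (2 * k)).det ≠ 0

variable [IsStrictOrderedRing K] {P : Matrix (Fin n) (Fin n) K}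

theorem IsEliminated.abs_le_pivot {k : Fin n} (h : IsEliminated P k) (hP : IsProperlyArranged P)
    {i j : Fin n} (hi : k ≤ i) (hj : k ≤ j) :
    |gjReal P (2 * k) i j| ≤ |gjReal P (2 * k) k k| := by
  have hcol := h.column
  rw [gjReal_eq_gjProd_mul] at hcol ⊢
  obtain ⟨c, hc⟩ := exists_mul_borderedMinor k
    (fun i j hj => gjProd_two_mul_apply_of_le P k.isLt.le i j hj) hcol
  rw [hc i j hi hj, hc k k le_rfl le_rfl, abs_mul, abs_mul]
  exact mul_le_mul_of_nonneg_left (hP k i j hi hj) (abs_nonneg c)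

/-- A zero pivot would dominate the rest of its row, which is already zero to its left, so the
determinant would vanish. -/
theorem IsEliminated.pivot_ne_zero {k : Fin n} (h : IsEliminated P k)
    (hP : IsProperlyArranged P) : gjReal P (2 * k) k k ≠ 0 := by
  intro h0
  refine h.det_ne_zero (Matrix.det_eq_zero_of_row_eq_zero k fun j => ?_)
  rcases lt_or_ge j k with hj | hj
  · rw [h.column k j hj, Matrix.one_apply_ne hj.ne']
  · have := h.abs_le_pivot hP le_rfl hj
    rwa [h0, abs_zero, abs_nonpos_iff] at this

theorem gjReal_odd_apply (P : Matrix (Fin n) (Fin n) K) (k i j : Fin n) :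
    gjReal P (2 * k + 1) i j = if i = k then gjReal P (2 * k) k j / gjReal P (2 * k) k k
      else gjReal P (2 * k) i j := by
  rw [gjReal, gjStep_two_mul_mul_apply]
  split_ifs with h
  · rw [h]
  · rfl

theorem gjReal_even_apply (P : Matrix (Fin n) (Fin n) K) (k i j : Fin n) :
    gjReal P (2 * (k + 1)) i j = if i = k then gjReal P (2 * k + 1) k j
      else gjReal P (2 * k) i j - gjReal P (2 * k) i k * gjReal P (2 * k + 1) k j := by
  rw [show 2 * ((k : ℕ) + 1) = 2 * k + 1 + 1 by ring, gjReal, gjStep_two_mul_add_one_mul_apply]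
  split_ifs with h
  · rw [h]
  · rw [gjReal_odd_apply P k i j, gjReal_odd_apply P k i k, if_neg h, if_neg h]

theorem IsEliminated.abs_pivot_row_le {k : Fin n} (h : IsEliminated P k)
    (hP : IsProperlyArranged P) (j : Fin n) : |gjReal P (2 * k + 1) k j| ≤ 1 := by
  rw [gjReal_odd_apply, if_pos rfl, abs_div]
  rcases lt_or_ge j k with hj | hj
  · rw [h.column k j hj, Matrix.one_apply_ne hj.ne', abs_zero, zero_div]
    exact zero_le_one
  · exact div_le_one_of_le₀ (h.abs_le_pivot hP le_rfl hj) (abs_nonneg _)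

theorem IsEliminated.abs_odd_le {k : Fin n} (h : IsEliminated P k)
    (hP : IsProperlyArranged P) (i j : Fin n) : |gjReal P (2 * k + 1) i j| ≤ 2 ^ (k : ℕ) := by
  by_cases hik : i = k
  · rw [hik]
    exact (h.abs_pivot_row_le hP j).trans (one_le_pow₀ one_le_two)
  · rw [gjReal_odd_apply, if_neg hik]
    exact h.abs_le i j

theorem IsEliminated.succ {k : Fin n} (h : IsEliminated P k) (hP : IsProperlyArranged P) :
    IsEliminated P (k + 1) where
  abs_le i j := by
    rw [gjReal_even_apply]
    split_ifs
    · exact (h.abs_pivot_row_le hP j).trans (one_le_pow₀ one_le_two)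
    -- A bounded entry is changed by a bounded entry times a pivot row entry of absolute value at
    -- most 1, so the bound doubles.
    · refine (abs_sub _ _).trans ?_
      rw [abs_mul, pow_succ, mul_two]
      exact add_le_add (h.abs_le i j)
        ((mul_le_of_le_one_right (abs_nonneg _) (h.abs_pivot_row_le hP j)).trans (h.abs_le i k))
  column i j hj := by
    have hp := h.pivot_ne_zero hP
    rw [gjReal_even_apply, gjReal_odd_apply, if_pos rfl]
    rcases Nat.lt_succ_iff_lt_or_eq.mp hj with hj | hj
    · have hj' : j < k := hj
      rw [h.column k j hj, h.column i j hj, Matrix.one_apply_ne hj'.ne', zero_div, mul_zero,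
        sub_zero, Matrix.one_apply]
      split_ifs with h1 h2 h2
      · exact absurd (h1.symm.trans h2) hj'.ne'
      all_goals rfl
    · obtain rfl : j = k := Fin.ext hj
      rw [div_self hp, mul_one, sub_self, Matrix.one_apply]
  det_ne_zero := by
    have h1 := gjStep_two_mul_mul_diagonal k _ (h.pivot_ne_zero hP)
    have h2 := gjStep_two_mul_add_one_mul_neg k (gjReal P (2 * k + 1))
    have h1 := left_ne_zero_of_mul_eq_one ((Matrix.det_mul _ _).symm.trans
      ((congrArg Matrix.det h1).trans Matrix.det_one))
    have h2 := left_ne_zero_of_mul_eq_one ((Matrix.det_mul _ _).symm.trans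
      ((congrArg Matrix.det h2).trans Matrix.det_one))
    rw [show 2 * ((k : ℕ) + 1) = 2 * k + 1 + 1 by ring, gjReal, Matrix.det_mul]
    refine mul_ne_zero h2 ?_
    rw [gjReal, Matrix.det_mul]
    exact mul_ne_zero h1 h.det_ne_zero

theorem isEliminated (hP : IsProperlyArranged P) (habs : ∀ i j, |P i j| ≤ 1) (hdet : P.det ≠ 0)
    {k : ℕ} (hk : k ≤ n) : IsEliminated P k := by
  induction k with
  | zero => exact ⟨fun i j => by simpa [gjReal] using habs i j, by simp, hdet⟩
  | succ k ih => exact IsEliminated.succ (k := ⟨k, hk⟩) (ih (by omega)) hP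

theorem gjReal_two_mul_eq_one (hP : IsProperlyArranged P) (habs : ∀ i j, |P i j| ≤ 1)
    (hdet : P.det ≠ 0) : gjReal P (2 * n) = 1 := by
  ext i j
  exact (isEliminated hP habs hdet le_rfl).column i j j.isLt

theorem mem_limitedSet_of_abs_le_two_pow {x : K} {k : ℕ} (h : |x| ≤ 2 ^ k) : x ∈ limitedSet K :=
  ⟨2 ^ k, by simpa using h⟩

end Pivots

/-! ### Stability along the elimination -/

section Main

variable {K : Type*} [Field K] [LinearOrder K] [IsStrictOrderedRing K] {n : ℕ} {R B : Set K}
  {P : Matrix (Fin n) (Fin n) K} {A : Matrix (Fin n) (Fin n) (Set K)} {β : Fin n → Set K}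

/-- The reciprocal of the pivot may be unlimited, but the inverse step multiplies by the pivot, a
limited entry. -/
theorem StableData.gaussJordan_odd (hR : IsNeutrix R) (hB : IsNeutrix B)
    (hP : IsProperlyArranged P) {k : Fin n} (hk : IsEliminated P k)
    (h : StableData R B (gjReal P (2 * k)) (gjCoeff P A (2 * k)) (gjRhs P β (2 * k))) :
    StableData R B (gjReal P (2 * k + 1)) (gjCoeff P A (2 * k + 1)) (gjRhs P β (2 * k + 1)) := by
  refine h.mul hR hB (gjStep_two_mul_mul_diagonal k _ (hk.pivot_ne_zero hP)) (fun i j => ?_)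
    fun i j => mem_limitedSet_of_abs_le_two_pow (hk.abs_odd_le hP i j)
  rw [Matrix.diagonal_apply]
  split_ifs
  exacts [h.limited k k, (limitedSubring K).one_mem, (limitedSubring K).zero_mem]

theorem StableData.gaussJordan_even (hR : IsNeutrix R) (hB : IsNeutrix B)
    {k : Fin n} (hk : IsEliminated P (k + 1))
    (h : StableData R B (gjReal P (2 * k + 1)) (gjCoeff P A (2 * k + 1)) (gjRhs P β (2 * k + 1))) :
    StableData R B (gjReal P (2 * (k + 1))) (gjCoeff P A (2 * (k + 1)))
      (gjRhs P β (2 * (k + 1))) := by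
  refine h.mul hR hB (gjStep_two_mul_add_one_mul_neg k _) (fun i j => ?_)
    fun i j => mem_limitedSet_of_abs_le_two_pow (hk.abs_le i j)
  rw [gjStep_two_mul_add_one, Matrix.neg_apply, neg_neg]
  split_ifs
  exacts [(limitedSubring K).one_mem, h.limited i j, (limitedSubring K).zero_mem]

theorem StableData.gaussJordan (hR : IsNeutrix R) (hB : IsNeutrix B)
    (hP : IsProperlyArranged P) (habs : ∀ i j, |P i j| ≤ 1) (h : StableData R B P A β) {q : ℕ}
    (hq : q ≤ 2 * n) : StableData R B (gjReal P q) (gjCoeff P A q) (gjRhs P β q) := by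
  have he : ∀ {k}, k ≤ n → IsEliminated P k := isEliminated hP habs h.det_ne_zero
  induction q with
  | zero => exact h
  | succ q ih =>
    have ih := ih (by omega)
    rcases Nat.even_or_odd' q with ⟨k, rfl | rfl⟩
    · exact StableData.gaussJordan_odd (k := ⟨k, by omega⟩) hR hB hP (he (by simp; omega)) ih
    · exact StableData.gaussJordan_even (k := ⟨k, by omega⟩) hR hB (he (by simp; omega)) ih

end Main

end Flexible

theorem mainTheorem2 {K : Type*} [Field K] [LinearOrder K] [IsStrictOrderedRing K]
    {n : ℕ} [NeZero n]
    (A : Matrix (Fin n) (Fin n) (Set K)) (β : Fin n → Set K) (P : Matrix (Fin n) (Fin n) K)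
    (hunif : Flexible.IsUniform β)
    (hP : Flexible.IsProperlyArrangedWrt A P)
    (hPred : Flexible.IsReduced (Flexible.ofReal P))
    (hstable : Flexible.IsStableSystem A β) :
    (∀ q ≤ 2 * n, Flexible.IsStableSystem (Flexible.gjCoeff P A q) (Flexible.gjRhs P β q)) ∧
    Flexible.IsNearIdentity (Flexible.gjCoeff P A (2 * n)) ∧
    Flexible.IsStableSystem (Flexible.ofReal (Flexible.gjTotal P) * A)
      (Flexible.extMulVec (Flexible.ofReal (Flexible.gjTotal P)) β) ∧
    Flexible.IsNearIdentity (Flexible.ofReal (Flexible.gjTotal P) * A) := by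
  have habs : ∀ i j, |P i j| ≤ 1 := by
    intro i j
    obtain ⟨_, rfl, h⟩ := hPred.exists_abs_le i j
    exact h
  have hlim : ∀ i j, P i j ∈ Flexible.limitedSet K := fun i j => ⟨1, by simpa using habs i j⟩
  obtain ⟨R, B, hR, hB, hRinf, h⟩ :=
    Flexible.StableData.of_isStableSystem hunif hstable hP.representative hlim
  have hone := Flexible.gjReal_two_mul_eq_one hP.arranged habs h.det_ne_zero
  -- The inverse of the total product is P itself, which is limited, so a single multiplication
  -- suffices. The case is separate because Minkowski products of matrices need not be associative.
  have hGP : Flexible.gjTotal P * P = 1 := (Flexible.gjReal_eq_gjProd_mul P _).symm.trans hone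
  have hseq : ∀ q ≤ 2 * n, Flexible.StableData R B (Flexible.gjReal P q) (Flexible.gjCoeff P A q)
      (Flexible.gjRhs P β q) := fun q hq => h.gaussJordan hR hB hP.arranged habs hq
  have hfin := hseq _ le_rfl
  rw [hone] at hfin
  have htot := h.mul hR hB hGP hlim fun i j => by
    rw [hGP, Matrix.one_apply]
    split_ifs
    exacts [(Flexible.limitedSubring K).one_mem, (Flexible.limitedSubring K).zero_mem]
  rw [hGP] at htot
  exact ⟨fun q hq => (hseq q hq).isStableSystem hR hB hRinf, hfin.isNearIdentity hRinf,
    htot.isStableSystem hR hB hRinf, htot.isNearIdentity hRinf⟩
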